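/- All graphs are finite, simple and nonnull. For a graph $G$, $\omega(G)$ is the maximum size of a clique of $G$, $\chi(G)$ is the chromatic number of $G$, and $N_G[v]$ is the set consisting of $v$ and all neighbors of $v$ in $G$. Let $k \ge 4$ be an integer; indices of sets $X_1,\dots,X_k$ are taken modulo $k$. A $k$-ring is a graph $R$ whose vertex set can be partitioned into nonempty sets $X_1,\dots,X_k$ such that for all $i \in \{1,\dots,k\}$ the set $X_i$ can be ordered as $X_i = \{u_i^1,\dots,u_i^{|X_i|}\}$ so that $$X_i \subseteq N_R[u_i^{|X_i|}] \subseteq \dots \subseteq N_R[u_i^1] = X_{i-1} \cup X_i \cup X_{i+1}.$$ A $k$-hyperhole is a graph $H$ whose vertex set can be partitioned into nonempty cliques $X_1,\dots,X_k$ such that for all $i \in \{1,\dots,k\}$, every vertex of $X_i$ is adjacent to every vertex of $X_{i-1} \cup X_{i+1}$ and to no vertex of $V(H) \setminus (X_{i-1} \cup X_i \cup X_{i+1})$. A $k$-hyperhole in $R$ is an induced subgraph of $R$ that is a $k$-hyperhole. Corollary. Let $k \ge 4$ be an integer, and let $R$ be a $k$-ring. Then $$\chi(R) = \max\left(\{\omega(R)\}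 \cup \left\{\left\lceil \frac{|V(H)|}{\lfloor k/2 \rfloor} \right\rceil \;\middle|\; H \text{ is a } k\text{-hyperhole in } R\right\}\right).$$ -/

import Mathlib

namespace ColoringRings

/-- The closed neighbourhood `N_G[v] = N_G(v) ∪ {v}` of a vertex `v` of `G`. -/
def closedNbhd {V : Type*} (G : SimpleGraph V) (v : V) : Set V :=
  G.neighborSet v ∪ {v}

/-- `X` is a partition of the vertex type `V` into nonempty sets `X i`, indexed by the integers
modulo `k` (so that `i - 1` and `i + 1` are taken cyclically). -/
structure IsCyclicPartition {V : Type*} {k : ℕ} (X : ZMod k → Set V) : Prop where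
  nonempty : ∀ i, (X i).Nonempty
  disjoint : ∀ i j, i ≠ j → Disjoint (X i) (X j)
  cover : ⋃ i, X i = Set.univ

/-- `X` is a ring partition of `R`: each `X i` can be enumerated without repetition as
`u 0, …, u m` so that `X i ⊆ N[u m] ⊆ ⋯ ⊆ N[u 0] = X (i - 1) ∪ X i ∪ X (i + 1)`. -/
structure IsRingPartition {V : Type*} {k : ℕ} (R : SimpleGraph V) (X : ZMod k → Set V) :
    Prop where
  partition : IsCyclicPartition X
  ordering : ∀ i, ∃ (m : ℕ) (u : Fin (m + 1) → V),
    Function.Injective u ∧ Set.range u = X i ∧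
    X i ⊆ closedNbhd R (u (Fin.last m)) ∧
    (∀ a b : Fin (m + 1), a ≤ b → closedNbhd R (u b) ⊆ closedNbhd R (u a)) ∧
    closedNbhd R (u 0) = X (i - 1) ∪ X i ∪ X (i + 1)

/-- `R` is a `k`-ring, that is, a ring of length `k`. -/
def IsRing {V : Type*} (k : ℕ) (R : SimpleGraph V) : Prop :=
  4 ≤ k ∧ ∃ X : ZMod k → Set V, IsRingPartition R X

/-- `H` is a `k`-hyperhole: its vertex set is partitioned into nonempty cliques `X i` such that
`X i` is complete to `X (i - 1) ∪ X (i + 1)` and anticomplete to all vertices outside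
`X (i - 1) ∪ X i ∪ X (i + 1)`. -/
def IsHyperhole {V : Type*} (k : ℕ) (H : SimpleGraph V) : Prop :=
  4 ≤ k ∧ ∃ X : ZMod k → Set V, IsCyclicPartition X ∧
    (∀ i, H.IsClique (X i)) ∧
    (∀ i, ∀ x ∈ X i, ∀ y ∈ X (i - 1) ∪ X (i + 1), H.Adj x y) ∧
    (∀ i, ∀ x ∈ X i, ∀ y ∉ X (i - 1) ∪ X i ∪ X (i + 1), ¬ H.Adj x y)

end ColoringRings

namespace ColoringRings

open Finset

/-! Colour each class through a permutation of `Fin r` sending each colour to the position it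
occupies; positions beyond the class are left unused. Adjacency between consecutive classes is a
staircase `E` (closed downwards), and a clique number at most `r` says that `E a b` forces `a + b +
2 ≤ r`. An `r`-colouring is then a cyclic sequence of permutations in which no colour sits on
`E`-related positions.

For even `k`, identity and reversal alternate. For `k = 2 * n + 1`, start from the identity and
choose each next permutation greedily, favouring alternately small and large colours
(`exists_perm_no_improving_swap`). If the last one is the identity, the sequence closes up.
Otherwise some `t` sits too early; counting the disfavoured colours in early positions back along
the sequence (`exists_walk_initialComplete`) yields consecutively complete initial segments of total
size above `n * r`, which form a hyperhole.

The theorem follows with `r = χ - 1` when `ω < χ`; the lower bound holds because a colour class of a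
hyperhole has at most `⌊k/2⌋` vertices. -/

/-! ### Staircase relations and greedy permutations -/

/-- Two initial segments of lengths `y` and `z` are complete to each other with respect to `E`. -/
def InitialComplete (E : ℕ → ℕ → Prop) (y z : ℕ) : Prop :=
  ∀ a < y, ∀ b < z, E a b

theorem InitialComplete.mono {E : ℕ → ℕ → Prop} {y z y' z' : ℕ} (h : InitialComplete E y z)
    (hy : y' ≤ y) (hz : z' ≤ z) : InitialComplete E y' z' :=
  fun a ha b hb => h a (ha.trans_le hy) b (hb.trans_le hz)

theorem InitialComplete.add_le {E : ℕ → ℕ → Prop} {r y z : ℕ}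
    (hE : ∀ a b, E a b → a + b + 2 ≤ r) (h : InitialComplete E y z) (hy : y ≤ r) (hz : z ≤ r) :
    y + z ≤ r := by
  rcases Nat.eq_zero_or_pos y with rfl | hy0
  · omega
  rcases Nat.eq_zero_or_pos z with rfl | hz0
  · omega
  have := hE _ _ (h (y - 1) (by omega) (z - 1) (by omega))
  omega

/-- Among the permutations `τ` with no `E`-edge between `σ c` and `τ c`, there is one that puts
colours of small key into early positions as far as single exchanges allow. -/
theorem exists_perm_no_improving_swap {r : ℕ} {E : ℕ → ℕ → Prop}
    (hdown : ∀ a b a' b', a' ≤ a → b' ≤ b → E a b → E a' b')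
    (hE : ∀ a b, E a b → a + b + 2 ≤ r) (σ : Equiv.Perm (Fin r)) (key : Fin r → ℤ) :
    ∃ τ : Equiv.Perm (Fin r), (∀ c, ¬ E (σ c) (τ c)) ∧
      ∀ c d, key c < key d → τ d < τ c → E (σ c) (τ d) := by
  classical
  have hne : (univ.filter fun τ : Equiv.Perm (Fin r) => ∀ c, ¬ E (σ c) (τ c)).Nonempty := by
    -- Reversing `σ` gives position sum `r - 1`, one more than `E` permits.
    refine ⟨σ.trans Fin.revPerm, mem_filter.2 ⟨mem_univ _, fun c h => ?_⟩⟩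
    have h1 := hE _ _ h
    have h2 := (σ c).isLt
    simp only [Equiv.trans_apply, Fin.revPerm_apply, Fin.val_rev] at h1
    omega
  obtain ⟨τ, hτ, hmax⟩ := exists_max_image _
    (fun τ : Equiv.Perm (Fin r) => ∑ c, key c * ((τ c : ℕ) : ℤ)) hne
  have hτ := (mem_filter.1 hτ).2
  refine ⟨τ, hτ, fun c d hcd hlt => ?_⟩
  by_contra hcon
  have hne : c ≠ d := by rintro rfl; exact lt_irrefl _ hcd
  -- The exchange moves `d` to a later position, which is harmless by down-closure, so only `c`
  -- could obstruct it.
  have hmem : ∀ x, ¬ E (σ x) ((Equiv.swap c d).trans τ x) := by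
    intro x
    by_cases hxc : x = c
    · subst hxc
      simpa using hcon
    by_cases hxd : x = d
    · subst hxd
      intro h
      simp only [Equiv.trans_apply, Equiv.swap_apply_right] at h
      exact hτ x (hdown _ _ _ _ le_rfl (Fin.le_def.1 hlt.le) h)
    · simpa [Equiv.swap_apply_of_ne_of_ne hxc hxd] using hτ x
  have h := hmax _ (mem_filter.2 ⟨mem_univ _, hmem⟩)
  have hdiff : ∑ x, (key x * (((Equiv.swap c d).trans τ x : ℕ) : ℤ) - key x * ((τ x : ℕ) : ℤ))
      = (key c * ((τ d : ℕ) : ℤ) - key c * ((τ c : ℕ) : ℤ)) +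
        (key d * ((τ c : ℕ) : ℤ) - key d * ((τ d : ℕ) : ℤ)) := by
    rw [Fintype.sum_eq_add c d hne]
    · simp
    · rintro x ⟨hxc, hxd⟩
      simp [Equiv.swap_apply_of_ne_of_ne hxc hxd]
  rw [sum_sub_distrib] at hdiff
  have hlt' : ((τ d : ℕ) : ℤ) < ((τ c : ℕ) : ℤ) := by exact_mod_cast hlt
  nlinarith [mul_pos (sub_pos.2 hcd) (sub_pos.2 hlt')]

theorem card_filter_perm_lt {r m : ℕ} (τ : Equiv.Perm (Fin r)) (hm : m ≤ r) :
    #{c | (τ c : ℕ) < m} = m := by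
  have h : #{c | (τ c : ℕ) < m} = #{a : Fin r | (a : ℕ) < m} :=
    card_equiv τ (by simp)
  rw [h, Fin.card_filter_val_lt, min_eq_right hm]

/-- If no colour of `T` can be moved ahead of a colour outside `T`, then the number of colours
outside `T` among the first `m` positions is bounded by means of two mutually complete initial
segments. -/
theorem exists_initialComplete_card_le {r : ℕ} {E : ℕ → ℕ → Prop}
    (hdown : ∀ a b a' b', a' ≤ a → b' ≤ b → E a b → E a' b')
    (σ τ : Equiv.Perm (Fin r)) (T : Finset (Fin r))
    (hopt : ∀ c ∈ T, ∀ d ∉ T, τ d < τ c → E (σ c) (τ d)) (m : ℕ) :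
    ∃ y ≤ r, ∃ z ≤ m, z ≤ r ∧ InitialComplete E y z ∧
      #{d ∈ Tᶜ | (τ d : ℕ) < m} + #T ≤ z + #{c ∈ T | (σ c : ℕ) < y} := by
  classical
  rcases (univ.filter fun d => d ∈ Tᶜ ∧ (τ d : ℕ) < m).eq_empty_or_nonempty with h0 | hne
  · refine ⟨r, le_rfl, 0, Nat.zero_le _, Nat.zero_le _, fun _ _ _ hb => absurd hb (by omega), ?_⟩
    have h1 : #{d ∈ Tᶜ | (τ d : ℕ) < m} = 0 := by
      rw [card_eq_zero, ← h0]
      ext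
      simp
    simp [h1]
  · obtain ⟨d, hd, hmax⟩ := exists_max_image _ (fun d => (τ d : ℕ)) hne
    simp only [mem_filter, mem_univ, true_and, mem_compl, and_imp] at hd hmax
    set p : ℕ := (τ d : ℕ) with hp
    have hpr : p < r := (τ d).isLt
    -- With `p` the last of the first `m` positions held by a colour outside `T`, `y` is the height
    -- of column `p` of the staircase. Every colour of `T` placed after `p` has `σ`-position below
    -- `y`.
    obtain ⟨y, hyr, hy⟩ : ∃ y ≤ r, ∀ a < r, E a p ↔ a < y := by
      by_cases hall : ∀ a < r, E a p
      · exact ⟨r, le_rfl, fun a ha => ⟨fun _ => ha, fun _ => hall a ha⟩⟩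
      · push Not at hall
        refine ⟨Nat.find hall, ?_, fun a ha => ⟨fun h => ?_, fun h => ?_⟩⟩
        · exact (Nat.find_spec hall).1.le
        · by_contra hle
          exact (Nat.find_spec hall).2 (hdown _ _ _ _ (not_lt.1 hle) le_rfl h)
        · by_contra hn
          exact Nat.find_min hall h ⟨ha, hn⟩
    refine ⟨y, hyr, p + 1, hd.2, hpr, fun a ha b hb => ?_, ?_⟩
    · exact hdown _ _ _ _ le_rfl (by omega) ((hy a (by omega)).2 ha)
    · have h1 : #{d ∈ Tᶜ | (τ d : ℕ) < m} ≤ #{x ∈ Tᶜ | (τ x : ℕ) < p + 1} := by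
        refine card_le_card fun x hx => ?_
        simp only [mem_filter, mem_compl] at hx ⊢
        exact ⟨hx.1, Nat.lt_succ_of_le (hmax x hx.1 hx.2)⟩
      have h2 : #{x ∈ Tᶜ | (τ x : ℕ) < p + 1} + #{x ∈ T | (τ x : ℕ) < p + 1} = p + 1 := by
        refine Eq.trans ?_ (card_filter_perm_lt τ (Nat.succ_le_of_lt hpr))
        rw [← card_union_of_disjoint]
        · congr 1
          ext x
          simp only [mem_union, mem_filter, mem_compl, mem_univ, true_and]
          tauto
        · exact disjoint_filter_filter disjoint_compl_left
      have h3 : #{x ∈ T | (τ x : ℕ) < p + 1} + #{x ∈ T | ¬ (τ x : ℕ) < p + 1} = #T :=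
        card_filter_add_card_filter_not _
      have h4 : #{x ∈ T | ¬ (τ x : ℕ) < p + 1} ≤ #{c ∈ T | (σ c : ℕ) < y} := by
        refine card_le_card fun x hx => ?_
        simp only [mem_filter] at hx ⊢
        refine ⟨hx.1, (hy _ (σ x).isLt).1 (hopt x hx.1 d hd.1 ?_)⟩
        rw [Fin.lt_def]
        omega
      omega

/-! ### Cyclic sequences of permutations -/

/-- Iterating `exists_initialComplete_card_le` along a walk of permutations in which the two
colour sides alternate. -/
theorem exists_walk_initialComplete {r : ℕ} {E : ℕ → ℕ → ℕ → Prop}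
    (hdown : ∀ s a b a' b', a' ≤ a → b' ≤ b → E s a b → E s a' b')
    (τ : ℕ → Equiv.Perm (Fin r)) (U : ℕ → Finset (Fin r))
    (hU : ∀ s, U (s + 1) = (U s)ᶜ)
    (hopt : ∀ s, ∀ c ∈ U s, ∀ d ∉ U s, τ (s + 1) d < τ (s + 1) c → E s (τ s c) (τ (s + 1) d))
    (s : ℕ) : ∀ m ≤ r, ∃ y : ℕ → ℕ, y s ≤ m ∧ (∀ j ≤ s, y j ≤ r) ∧
      (∀ j < s, InitialComplete (E j) (y j) (y (j + 1))) ∧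
      #{d ∈ U s | (τ s d : ℕ) < m} + ∑ j ∈ range s, #(U j) ≤
        ∑ j ∈ range s, y (j + 1) + min #(U 0) (y 0) := by
  induction s with
  | zero =>
    intro m hm
    refine ⟨fun _ => m, le_rfl, fun _ _ => hm, fun _ h => absurd h (by omega), ?_⟩
    simp only [range_zero, sum_empty, add_zero, zero_add, le_min_iff]
    refine ⟨card_filter_le _ _, ?_⟩
    refine (card_le_card (filter_subset_filter _ (subset_univ _))).trans ?_
    exact (card_filter_perm_lt (τ 0) hm).le
  | succ s ih =>
    intro m hm
    obtain ⟨y', hy', z, hzm, hzr, hc, hle⟩ :=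
      exists_initialComplete_card_le (hdown s) (τ s) (τ (s + 1)) (U s) (hopt s) m
    obtain ⟨y, hys, hyr, hyc, hyle⟩ := ih y' hy'
    refine ⟨fun j => if j ≤ s then y j else z, by simpa using hzm, fun j hj => ?_,
      fun j hj => ?_, ?_⟩
    · dsimp only
      split_ifs with h
      · exact hyr j h
      · exact hzr
    · rcases Nat.lt_succ_iff_lt_or_eq.1 hj with h | rfl
      · simpa [h.le, Nat.succ_le_of_lt h] using hyc j h
      · simpa using hc.mono hys le_rfl
    · rw [sum_range_succ, sum_range_succ, hU s]
      have : ∑ j ∈ range s, (if j + 1 ≤ s then y (j + 1) else z) = ∑ j ∈ range s, y (j + 1) :=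
        sum_congr rfl fun j hj => if_pos (mem_range.1 hj)
      simp only [this, Nat.zero_le, if_true, Nat.not_succ_le_self, if_false]
      omega

theorem sum_range_two_mul_le {r : ℕ} (n : ℕ) (y : ℕ → ℕ)
    (h : ∀ j < 2 * n, y j + y (j + 1) ≤ r) : ∑ j ∈ range (2 * n), y j ≤ n * r := by
  induction n with
  | zero => simp
  | succ n ih =>
    have h1 := ih fun j hj => h j (by omega)
    have h2 := h (2 * n) (by omega)
    rw [show 2 * (n + 1) = 2 * n + 1 + 1 by ring, sum_range_succ, sum_range_succ, add_mul]
    omega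

theorem sum_zmod_eq_sum_range {k : ℕ} [NeZero k] (g : ZMod k → ℕ) (a : ZMod k) :
    ∑ i, g i = ∑ j ∈ range k, g (a + j) := by
  refine sum_nbij' (fun i => (i - a).val) (fun j => a + j) ?_ ?_ ?_ ?_ ?_
  · intro i _
    exact mem_range.2 (ZMod.val_lt _)
  · intro j _
    exact mem_univ _
  · intro i _
    simp
  · intro j hj
    simp [ZMod.val_cast_of_lt (mem_range.1 hj)]
  · intro i _
    simp

/-- A permutation preserves the sum of all values, so it cannot move entries only upwards. -/
theorem exists_perm_apply_lt {r : ℕ} {τ : Equiv.Perm (Fin r)} (h : τ ≠ 1) : ∃ c, τ c < c := by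
  by_contra! hle
  apply h
  have hsum : ∑ c : Fin r, (c : ℕ) = ∑ c, ((τ c : Fin r) : ℕ) :=
    (Equiv.sum_comp τ fun c => (c : ℕ)).symm
  have := (sum_eq_sum_iff_of_le fun c _ => Fin.le_def.1 (hle c)).1 hsum
  ext c
  exact (this c (mem_univ c)).symm

/-- Odd cyclic sequences of bipartite "staircases": either there is a cyclic sequence of
compatible permutations, or some cyclically complete choice of initial segments is too large. -/
theorem exists_cyclic_perms_of_odd {n r : ℕ} {E : ZMod (2 * n + 1) → ℕ → ℕ → Prop}
    (hdown : ∀ i a b a' b', a' ≤ a → b' ≤ b → E i a b → E i a' b')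
    (hE : ∀ i a b, E i a b → a + b + 2 ≤ r)
    (hno : ∀ y : ZMod (2 * n + 1) → ℕ, (∀ i, 0 < y i) →
      (∀ i, InitialComplete (E i) (y i) (y (i + 1))) → ∑ i, y i ≤ n * r) :
    ∃ τ : ZMod (2 * n + 1) → Equiv.Perm (Fin r), ∀ i c, ¬ E i (τ i c) (τ (i + 1) c) := by
  classical
  choose f hf hfopt using fun (s : ℕ) (σ : Equiv.Perm (Fin r)) =>
    exists_perm_no_improving_swap (hdown (s : ZMod (2 * n + 1))) (hE _) σ
      -- Odd-indexed permutations favour small colours, so `τ (2 * n + 1)` is steered towards the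
      -- identity; even-indexed ones after the start favour large colours, to make room.
      (fun c => if Even s then ((c : ℕ) : ℤ) else -((c : ℕ) : ℤ))
  let τ : ℕ → Equiv.Perm (Fin r) := fun s => Nat.rec 1 (fun s σ => f s σ) s
  have hval : ∀ i : ZMod (2 * n + 1), i + 1 ≠ 0 → (i + 1).val = i.val + 1 := by
    intro i hi
    have h1 : i + 1 = ((i.val + 1 : ℕ) : ZMod (2 * n + 1)) := by
      push_cast
      rw [ZMod.natCast_zmod_val]
    have h2 : i.val + 1 ≠ 2 * n + 1 := fun h => hi (by rw [h1, h, ZMod.natCast_self])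
    have h3 := ZMod.val_lt i
    rw [h1, ZMod.val_cast_of_lt (by omega)]
  have hval0 : ∀ i : ZMod (2 * n + 1), i + 1 = 0 → i.val + 1 = 2 * n + 1 := by
    intro i hi
    have h1 : ((i.val + 1 : ℕ) : ZMod (2 * n + 1)) = 0 := by
      push_cast
      rw [ZMod.natCast_zmod_val, hi]
    exact le_antisymm (ZMod.val_lt i)
      (Nat.le_of_dvd (Nat.succ_pos _) ((ZMod.natCast_eq_zero_iff _ _).1 h1))
  by_cases hclose : τ (2 * n + 1) = 1
  · refine ⟨fun i => τ i.val, fun i c => ?_⟩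
    have hs := hf i.val (τ i.val) c
    rw [ZMod.natCast_zmod_val] at hs
    have : τ (i + 1).val = f i.val (τ i.val) := by
      by_cases hi : i + 1 = 0
      · have h1 : τ (i.val + 1) = f i.val (τ i.val) := rfl
        rw [← h1, hval0 i hi, hclose, hi, ZMod.val_zero]
        rfl
      · rw [hval i hi]
    simp only [this]
    exact hs
  exfalso
  obtain ⟨t, ht⟩ := exists_perm_apply_lt hclose
  let T : Finset (Fin r) := {c | c < t}
  -- `U s` is the side favoured when `τ (s + 1)` is chosen.
  let U : ℕ → Finset (Fin r) := fun s => if Even s then T else Tᶜ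
  have hU : ∀ s, U (s + 1) = (U s)ᶜ := by
    intro s
    by_cases hs : Even s <;> simp [U, hs, Nat.even_add_one]
  have hT : #T = t := by
    have h := card_filter_perm_lt (1 : Equiv.Perm (Fin r)) t.isLt.le
    simpa only [Equiv.Perm.one_apply, Fin.val_fin_lt] using h
  have hcard : ∀ l, ∑ j ∈ range (2 * l), #(U j) = l * r := by
    intro l
    induction l with
    | zero => simp
    | succ l ih =>
      rw [show 2 * (l + 1) = 2 * l + 1 + 1 by ring, sum_range_succ, sum_range_succ, ih, hU,
        add_assoc, card_add_card_compl, Fintype.card_fin]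
      ring
  obtain ⟨y, hyt, hyr, hyc, hyle⟩ := exists_walk_initialComplete
    (E := fun s => E (s : ZMod (2 * n + 1))) (fun s => hdown _) τ U hU
    (fun s c hc d hd hlt => hfopt s (τ s) c d (by
      by_cases hs : Even s
      · simp only [U, T, hs, if_true, mem_filter, mem_univ, true_and, not_lt] at hc hd ⊢
        exact_mod_cast Fin.lt_def.1 (hc.trans_le hd)
      · simp only [U, T, hs, if_false, mem_compl, mem_filter, mem_univ, true_and, not_lt,
          not_le] at hc hd ⊢
        exact neg_lt_neg (by exact_mod_cast Fin.lt_def.1 (hd.trans_le hc))) hlt)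
    (2 * n + 1) t t.isLt.le
  have hpos : 0 < #{d ∈ U (2 * n + 1) | (τ (2 * n + 1) d : ℕ) < t} := by
    refine card_pos.2 ⟨t, mem_filter.2 ⟨?_, Fin.lt_def.1 ht⟩⟩
    simp [U, T]
  have hU0 : #(U 0) = t := by simpa [U] using hT
  have hU2n : #(U (2 * n)) = t := by simpa [U] using hT
  rw [sum_range_succ (fun j => #(U j)), hcard, hU0, hU2n, sum_range_succ] at hyle
  -- The walk visits class `0` at both ends, so the smaller segment is kept. Since `y (2 * n + 1) ≤
  -- t`, the counting bound for the walk survives this loss.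
  let w : ZMod (2 * n + 1) → ℕ := fun i =>
    if i = 0 then min (y (2 * n + 1)) (y 0) else y i.val
  have hw1 : ∀ i, w i ≤ y i.val := by
    intro i
    by_cases hi : i = 0 <;> simp [w, hi]
  have hw2 : ∀ i, w (i + 1) ≤ y (i.val + 1) := by
    intro i
    by_cases hi : i + 1 = 0
    · simp [w, hi, hval0 i hi]
    · simp [w, hi, hval i hi]
  have hwr : ∀ i, w i ≤ r := fun i => (hw1 i).trans (hyr _ (ZMod.val_lt i).le)
  have hwc : ∀ i, InitialComplete (E i) (w i) (w (i + 1)) := by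
    intro i
    have := hyc i.val (ZMod.val_lt i)
    rw [ZMod.natCast_zmod_val] at this
    exact this.mono (hw1 i) (hw2 i)
  have hsum : n * r < ∑ i, w i := by
    rw [sum_zmod_eq_sum_range w 0, sum_range_succ']
    have h1 : ∑ j ∈ range (2 * n), w (0 + ((j + 1 : ℕ) : ZMod (2 * n + 1))) =
        ∑ j ∈ range (2 * n), y (j + 1) := by
      refine sum_congr rfl fun j hj => ?_
      have hj' : (((j + 1 : ℕ) : ZMod (2 * n + 1))).val = j + 1 :=
        ZMod.val_cast_of_lt (by have := mem_range.1 hj; omega)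
      have hne : ((j + 1 : ℕ) : ZMod (2 * n + 1)) ≠ 0 := by
        intro h
        rw [h, ZMod.val_zero] at hj'
        omega
      rw [zero_add]
      simp only [w, if_neg hne, hj']
    have h2 : w (0 + ((0 : ℕ) : ZMod (2 * n + 1))) = min (y (2 * n + 1)) (y 0) := by simp [w]
    rw [h1, h2]
    omega
  -- If one segment were empty, the other `2 * n` would split into consecutive pairs of sum at most
  -- `r`, for a total of at most `n * r`.
  have hwpos : ∀ i, 0 < w i := by
    intro a
    by_contra h0
    have h0 : w a = 0 := by omega
    have := sum_range_two_mul_le (r := r) n (fun j => w (a + ((j + 1 : ℕ) : ZMod (2 * n + 1))))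
      fun j _ => by
        have h := (hwc (a + ((j + 1 : ℕ) : ZMod (2 * n + 1)))).add_le (hE _) (hwr _) (hwr _)
        rw [add_assoc] at h
        exact_mod_cast h
    rw [sum_zmod_eq_sum_range w a, sum_range_succ'] at hsum
    simp only [Nat.cast_zero, add_zero, h0] at hsum
    omega
  exact absurd (hno w hwpos hwc) (not_le.2 hsum)

/-- For even cycles, alternating the identity with the reversal is always compatible. -/
theorem exists_cyclic_perms_of_even {n r : ℕ} (hn : n ≠ 0) {E : ZMod (2 * n) → ℕ → ℕ → Prop}
    (hE : ∀ i a b, E i a b → a + b + 2 ≤ r) :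
    ∃ τ : ZMod (2 * n) → Equiv.Perm (Fin r), ∀ i c, ¬ E i (τ i c) (τ (i + 1) c) := by
  classical
  have : NeZero (2 * n) := ⟨by omega⟩
  let p : ZMod (2 * n) →+* ZMod 2 := ZMod.castHom (dvd_mul_right 2 n) (ZMod 2)
  refine ⟨fun i => if p i = 0 then 1 else Fin.revPerm, fun i c h => ?_⟩
  have h1 := hE _ _ _ h
  have h2 := c.isLt
  have h3 : p (i + 1) = p i + 1 := by rw [map_add, map_one]
  simp only [h3] at h1
  have h4 : ∀ q : ZMod 2, q = 0 ∨ q = 1 := by decide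
  have h5 : (1 : ZMod 2) + 1 = 0 := by decide
  rcases h4 (p i) with hq | hq <;>
  · simp [hq, h5, Fin.val_rev] at h1
    omega

/-! ### Lower bound from hyperholes -/

/-- A colour class meets each clique at most once and never two consecutive ones, so its index set
is disjoint from its shift by one and has at most `k / 2` elements. -/
theorem IsHyperhole.card_le_of_colorable {W : Type*} [Fintype W] {k : ℕ} {H : SimpleGraph W}
    (hH : IsHyperhole k H) {c : ℕ} (hc : H.Colorable c) : Fintype.card W ≤ k / 2 * c := by
  classical
  obtain ⟨hk, X, hX, hclique, hcomplete, -⟩ := hH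
  have : NeZero k := ⟨by omega⟩
  obtain ⟨C⟩ := hc
  have hcover : ∀ x, ∃ i, x ∈ X i := fun x =>
    Set.mem_iUnion.1 (hX.cover ▸ Set.mem_univ x)
  choose idx hidx using hcover
  have hfiber : ∀ a, #{x | C x = a} ≤ k / 2 := by
    intro a
    set F : Finset W := {x | C x = a}
    have hF : ∀ x ∈ F, ∀ y ∈ F, ¬ H.Adj x y := by
      intro x hx y hy hadj
      exact C.valid hadj ((mem_filter.1 hx).2.trans (mem_filter.1 hy).2.symm)
    have hinj : #(F.image idx) = #F := by
      refine card_image_of_injOn fun x hx y hy hxy => ?_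
      by_contra hne
      exact hF x hx y hy (hclique _ (hidx x) (by rw [hxy]; exact hidx y) hne)
    have hdisj : Disjoint (F.image idx) ((F.image idx).image (· + 1)) := by
      rw [disjoint_left]
      intro i hi hi'
      obtain ⟨x, hx, rfl⟩ := mem_image.1 hi
      obtain ⟨j, hj, hji⟩ := mem_image.1 hi'
      obtain ⟨y, hy, rfl⟩ := mem_image.1 hj
      refine hF y hy x hx (hcomplete _ _ (hidx y) _ (Or.inr ?_))
      rw [hji]
      exact hidx x
    have h1 := card_union_of_disjoint hdisj
    rw [card_image_of_injective _ (add_left_injective 1), hinj] at h1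
    have h2 := card_le_univ (F.image idx ∪ (F.image idx).image (· + 1))
    rw [ZMod.card] at h2
    omega
  have h := card_le_mul_card_image_of_maps_to (s := (univ : Finset W)) (t := univ) (f := C)
    (fun _ _ => mem_univ _) (k / 2) fun a _ => hfiber a
  simpa using h

/-! ### Rings as cyclic sequences of staircases -/

/-- The enumerated version of a ring partition, positions being numbered from `0`. -/
structure RingEnumeration {V : Type*} (k : ℕ) (R : SimpleGraph V) where
  len : ZMod k → ℕ
  u : ∀ i, Fin (len i) → V
  surj : ∀ v, ∃ i p, u i p = v
  index_eq : ∀ {i j p q}, u i p = u j q → i = j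
  injective : ∀ i, Function.Injective (u i)
  adj_same : ∀ i p q, p ≠ q → R.Adj (u i p) (u i q)
  adj_of_le : ∀ {i j p p' q}, i ≠ j → p' ≤ p → R.Adj (u i p) (u j q) → R.Adj (u i p') (u j q)
  index_of_adj : ∀ {i j p q}, R.Adj (u i p) (u j q) → j = i ∨ j = i + 1 ∨ i = j + 1

theorem IsRingPartition.exists_ringEnumeration {V : Type*} {k : ℕ} {R : SimpleGraph V}
    {X : ZMod k → Set V} (hX : IsRingPartition R X) : Nonempty (RingEnumeration k R) := by
  choose m u hinj hrange hlast hmono hzero using hX.ordering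
  have hmem : ∀ i p, u i p ∈ X i := fun i p => hrange i ▸ Set.mem_range_self p
  have huniq : ∀ {v i j}, v ∈ X i → v ∈ X j → i = j := by
    intro v i j hi hj
    by_contra hne
    exact Set.disjoint_left.1 (hX.partition.disjoint i j hne) hi hj
  refine ⟨⟨fun i => m i + 1, u, fun v => ?_, fun {i j p q} h => ?_, hinj, fun i p q hpq => ?_,
    fun {i j p p' q} hij hle hadj => ?_, fun {i j p q} hadj => ?_⟩⟩
  · obtain ⟨i, hi⟩ := Set.mem_iUnion.1 (hX.partition.cover ▸ Set.mem_univ v)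
    rw [← hrange i] at hi
    obtain ⟨p, hp⟩ := hi
    exact ⟨i, p, hp⟩
  · exact huniq (hmem i p) (h ▸ hmem j q)
  · rcases hmono i p (Fin.last _) (Fin.le_last p) (hlast i (hmem i q)) with h | h
    · exact h
    · exact absurd (hinj i h).symm hpq
  · rcases hmono i p' p hle (Or.inl hadj) with h | h
    · exact h
    · have h' : u j q = u i p' := h
      exact absurd (huniq (hmem i p') (h' ▸ hmem j q)) hij
  · have h := hmono i 0 p (Fin.zero_le p) (Or.inl hadj)
    rw [hzero i] at h
    rcases h with (h | h) | h
    · right; right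
      rw [huniq (hmem j q) h, sub_add_cancel]
    · exact Or.inl (huniq (hmem j q) h)
    · exact Or.inr (Or.inl (huniq (hmem j q) h))

namespace RingEnumeration

variable {V : Type*} {k : ℕ} {R : SimpleGraph V} (D : RingEnumeration k R)

/-- Adjacency between the `a`-th vertex of one class and the `b`-th vertex of the next one. -/
def Linked (i : ZMod k) (a b : ℕ) : Prop :=
  ∃ (p : Fin (D.len i)) (q : Fin (D.len (i + 1))),
    (p : ℕ) = a ∧ (q : ℕ) = b ∧ R.Adj (D.u i p) (D.u (i + 1) q)

theorem Linked.mono (hk : 1 < k) {i : ZMod k} {a b a' b' : ℕ} (ha : a' ≤ a) (hb : b' ≤ b)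
    (h : D.Linked i a b) : D.Linked i a' b' := by
  have : Fact (1 < k) := ⟨hk⟩
  obtain ⟨p, q, rfl, rfl, hadj⟩ := h
  have hne : i ≠ i + 1 := by simp
  refine ⟨⟨a', ha.trans_lt p.isLt⟩, ⟨b', hb.trans_lt q.isLt⟩, rfl, rfl, ?_⟩
  exact D.adj_of_le hne ha (D.adj_of_le hne.symm hb hadj.symm).symm

theorem len_le_cliqueNum [Finite V] (i : ZMod k) : D.len i ≤ R.cliqueNum := by
  classical
  have hcl : R.IsClique (univ.map ⟨D.u i, D.injective i⟩ : Finset V) := by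
    intro x hx y hy hne
    simp only [coe_map, Function.Embedding.coeFn_mk, coe_univ, Set.image_univ,
      Set.mem_range] at hx hy
    obtain ⟨p, rfl⟩ := hx
    obtain ⟨q, rfl⟩ := hy
    exact D.adj_same i p q fun h => hne (by rw [h])
  simpa using hcl.card_le_cliqueNum

/-- By nestedness, the vertices up to position `a` in one class and up to `b` in the next form a
clique of size `a + b + 2`. -/
theorem Linked.add_le [Finite V] (hk : 1 < k) {i : ZMod k} {a b : ℕ} (h : D.Linked i a b) :
    a + b + 2 ≤ R.cliqueNum := by
  classical
  have : Fact (1 < k) := ⟨hk⟩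
  have hne : i ≠ i + 1 := by simp
  obtain ⟨p, q, rfl, rfl, hadj⟩ := h
  let A : Finset V := (Iic p).map ⟨D.u i, D.injective i⟩
  let B : Finset V := (Iic q).map ⟨D.u (i + 1), D.injective (i + 1)⟩
  have hAB : Disjoint A B := by
    rw [disjoint_left]
    intro x hx hy
    obtain ⟨p', -, rfl⟩ := mem_map.1 hx
    obtain ⟨q', -, h⟩ := mem_map.1 hy
    exact hne (D.index_eq h).symm
  have hadj' : ∀ p' ≤ p, ∀ q' ≤ q, R.Adj (D.u i p') (D.u (i + 1) q') := fun p' hp q' hq =>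
    D.adj_of_le hne hp (D.adj_of_le hne.symm hq hadj.symm).symm
  have hcl : R.IsClique (A ∪ B : Finset V) := by
    intro x hx y hy hxy
    rw [mem_coe, mem_union] at hx hy
    rcases hx with hx | hx <;> rcases hy with hy | hy <;>
      obtain ⟨s, hs, rfl⟩ := mem_map.1 hx <;> obtain ⟨t, ht, rfl⟩ := mem_map.1 hy
    · exact D.adj_same _ _ _ fun h => hxy (by rw [h])
    · exact hadj' s (mem_Iic.1 hs) t (mem_Iic.1 ht)
    · exact (hadj' t (mem_Iic.1 ht) s (mem_Iic.1 hs)).symm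
    · exact D.adj_same _ _ _ fun h => hxy (by rw [h])
  have h := hcl.card_le_cliqueNum
  rw [card_union_of_disjoint hAB, card_map, card_map, Fin.card_Iic, Fin.card_Iic] at h
  omega

theorem colorable_of_perms {r : ℕ} (hlen : ∀ i, D.len i ≤ r)
    (τ : ZMod k → Equiv.Perm (Fin r)) (hτ : ∀ i c, ¬ D.Linked i (τ i c) (τ (i + 1) c)) :
    R.Colorable r := by
  choose idx pos hpos using D.surj
  let C : V → Fin r := fun v => (τ (idx v)).symm ⟨pos v, (pos v).isLt.trans_le (hlen _)⟩
  have hC : ∀ i p, (τ i (C (D.u i p)) : ℕ) = p := by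
    intro i p
    have hC' : (τ (idx (D.u i p)) (C (D.u i p)) : ℕ) = pos (D.u i p) := by simp [C]
    have h := hpos (D.u i p)
    -- The type of the position depends on the chosen index, so both are generalized before the
    -- indices are identified.
    generalize pos (D.u i p) = q at hC' h
    generalize idx (D.u i p) = j at q hC' h
    obtain rfl := D.index_eq h
    rw [hC', D.injective _ h]
  have hnext : ∀ i p q, R.Adj (D.u i p) (D.u (i + 1) q) →
      C (D.u i p) ≠ C (D.u (i + 1) q) := by
    intro i p q hadj hcol
    refine hτ i (C (D.u i p)) ⟨p, q, (hC i p).symm, ?_, hadj⟩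
    rw [hcol, hC]
  refine ⟨⟨C, fun {v w} hadj => ?_⟩⟩
  obtain ⟨i, p, rfl⟩ := D.surj v
  obtain ⟨j, q, rfl⟩ := D.surj w
  rcases D.index_of_adj hadj with rfl | rfl | rfl
  · intro hcol
    have hpq : p = q := Fin.ext (by rw [← hC, ← hC, show C _ = C _ from hcol])
    exact hadj.ne (by rw [hpq])
  · exact hnext i p q hadj
  · exact (hnext j q p hadj.symm).symm

theorem exists_isHyperhole [Fintype V] (hk : 4 ≤ k) (y : ZMod k → ℕ) (hpos : ∀ i, 0 < y i)
    (hy : ∀ i, InitialComplete (D.Linked i) (y i) (y (i + 1))) [NeZero k] :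
    ∃ S : Finset V, IsHyperhole k (R.induce (S : Set V)) ∧ #S = ∑ i, y i := by
  classical
  -- `Linked` holds only at positions of actual vertices, so completeness to a nonempty segment
  -- bounds `y i`.
  have hlen : ∀ i, y i ≤ D.len i := by
    intro i
    obtain ⟨p, -, hp, -⟩ := hy i (y i - 1) (by have := hpos i; omega) 0 (hpos _)
    have := p.isLt
    omega
  let P : Finset (Σ i, Fin (D.len i)) := univ.sigma fun i => {p | (p : ℕ) < y i}
  have hinj : Function.Injective fun x : Σ i, Fin (D.len i) => D.u x.1 x.2 := by
    rintro ⟨i, p⟩ ⟨j, q⟩ h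
    obtain rfl := D.index_eq h
    obtain rfl := D.injective _ h
    rfl
  have hmemS : ∀ v, v ∈ P.image (fun x => D.u x.1 x.2) ↔
      ∃ (i : ZMod k) (p : Fin (D.len i)), (p : ℕ) < y i ∧ D.u i p = v := by
    intro v
    simp [P]
  refine ⟨P.image fun x => D.u x.1 x.2, ⟨hk, fun i => {v | ∃ p : Fin (D.len i), (p : ℕ) < y i ∧ D.u i p = v.1},
    ⟨fun i => ?_, fun i j hij => ?_, ?_⟩, fun i => ?_, fun i => ?_, fun i => ?_⟩, ?_⟩
  · refine ⟨⟨D.u i ⟨0, (hpos i).trans_le (hlen i)⟩, ?_⟩, _, hpos i, rfl⟩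
    exact (hmemS _).2 ⟨i, _, hpos i, rfl⟩
  · rw [Set.disjoint_left]
    rintro v ⟨p, -, hp⟩ ⟨q, -, hq⟩
    exact hij (D.index_eq (hp.trans hq.symm))
  · rw [Set.eq_univ_iff_forall]
    rintro ⟨v, hv⟩
    obtain ⟨i, p, hp, rfl⟩ := (hmemS v).1 hv
    exact Set.mem_iUnion.2 ⟨i, p, hp, rfl⟩
  · rintro ⟨v, hv⟩ ⟨p, hp, rfl⟩ ⟨w, hw⟩ ⟨q, hq, rfl⟩ hne
    exact D.adj_same i p q fun h => hne (by subst h; rfl)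
  · have hnext : ∀ (i : ZMod k) (p : Fin (D.len i)) (q : Fin (D.len (i + 1))),
        (p : ℕ) < y i → (q : ℕ) < y (i + 1) →
        R.Adj (D.u i p) (D.u (i + 1) q) := by
      intro i p q hp hq
      obtain ⟨p', q', hp', hq', h⟩ := hy i p hp q hq
      rwa [Fin.ext hp', Fin.ext hq'] at h
    rintro ⟨v, hv⟩ ⟨p, hp, rfl⟩ ⟨w, hw⟩ (⟨q, hq, rfl⟩ | ⟨q, hq, rfl⟩)
    · obtain ⟨j, rfl⟩ : ∃ j, i = j + 1 := ⟨i - 1, by ring⟩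
      have hj : j + 1 - 1 = j := by ring
      change R.Adj _ _
      revert q
      rw [hj]
      intro q hq _
      exact (hnext j q p hq hp).symm
    · exact hnext i p q hp hq
  · rintro ⟨v, hv⟩ ⟨p, hp, rfl⟩ ⟨w, hw⟩ hnot hadj
    obtain ⟨j, q, hq, rfl⟩ := (hmemS w).1 hw
    have hadj' : R.Adj (D.u i p) (D.u j q) := hadj
    rcases D.index_of_adj hadj' with rfl | rfl | rfl
    · exact hnot (Or.inl (Or.inr ⟨q, hq, rfl⟩))
    · exact hnot (Or.inr ⟨q, hq, rfl⟩)
    · refine hnot (Or.inl (Or.inl ?_))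
      rw [add_sub_cancel_right]
      exact ⟨q, hq, rfl⟩
  · rw [card_image_of_injective _ hinj, card_sigma]
    refine sum_congr rfl fun i _ => ?_
    rw [Fin.card_filter_val_lt, min_eq_right (hlen i)]

end RingEnumeration

/-! ### Chromatic number of a ring -/

/-- A ring that cannot be coloured with `r ≥ ω` colours contains a hyperhole with more than
`r ⌊k/2⌋` vertices. -/
theorem RingEnumeration.colorable_or_exists_isHyperhole {V : Type*} [Fintype V] {k : ℕ}
    {R : SimpleGraph V} (D : RingEnumeration k R) (hk : 4 ≤ k) {r : ℕ} (hr : R.cliqueNum ≤ r) :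
    R.Colorable r ∨
      ∃ S : Finset V, IsHyperhole k (R.induce (S : Set V)) ∧ k / 2 * r < #S := by
  have hlen : ∀ i, D.len i ≤ r := fun i => (D.len_le_cliqueNum i).trans hr
  have hE : ∀ i a b, D.Linked i a b → a + b + 2 ≤ r := fun i a b h =>
    (Linked.add_le D (by omega) h).trans hr
  rcases Nat.even_or_odd' k with ⟨n, rfl | rfl⟩
  · obtain ⟨τ, hτ⟩ := exists_cyclic_perms_of_even (by omega) hE
    exact Or.inl (D.colorable_of_perms hlen τ hτ)
  · rw [or_iff_not_imp_left]
    intro hcol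
    by_contra! hno
    obtain ⟨τ, hτ⟩ := exists_cyclic_perms_of_odd (E := D.Linked)
      (fun i a b a' b' ha hb h => Linked.mono D (by omega) ha hb h) hE fun y hpos hy => by
        obtain ⟨S, hS, hcard⟩ := D.exists_isHyperhole hk y hpos hy
        have h := hno S hS
        rwa [hcard, show (2 * n + 1) / 2 = n by omega] at h
    exact hcol (D.colorable_of_perms hlen τ hτ)

end ColoringRings

theorem corollary1p3 {V : Type*} [Finite V] (k : ℕ) (hk : 4 ≤ k) (R : SimpleGraph V)
    (hR : ColoringRings.IsRing k R) :
    IsGreatest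
      ({(R.cliqueNum : ℕ∞)} ∪
        {m : ℕ∞ | ∃ S : Finset V, ColoringRings.IsHyperhole k (R.induce (S : Set V)) ∧
          m = ((⌈(S.card : ℚ) / ((k / 2 : ℕ) : ℚ)⌉₊ : ℕ) : ℕ∞)})
      R.chromaticNumber := by
  classical
  have : Fintype V := Fintype.ofFinite V
  obtain ⟨-, X, hX⟩ := hR
  obtain ⟨D⟩ := hX.exists_ringEnumeration
  obtain ⟨c, hc⟩ := ENat.ne_top_iff_exists.1
    (SimpleGraph.chromaticNumber_ne_top_iff_exists.2 ⟨_, R.colorable_of_fintype⟩)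
  have hcol : R.Colorable c := SimpleGraph.chromaticNumber_le_iff_colorable.1 hc.ge
  have hclique : R.cliqueNum ≤ c := by
    have := R.cliqueNum_le_chromaticNumber
    rw [← hc] at this
    exact_mod_cast this
  have hhalf : (0 : ℚ) < ((k / 2 : ℕ) : ℚ) := by
    have : 0 < k / 2 := by omega
    exact_mod_cast this
  have hhole : ∀ S : Finset V, ColoringRings.IsHyperhole k (R.induce (S : Set V)) →
      ⌈(S.card : ℚ) / ((k / 2 : ℕ) : ℚ)⌉₊ ≤ c := by
    intro S hS
    have hcS : (R.induce (S : Set V)).Colorable c :=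
      hcol.of_hom (SimpleGraph.Embedding.induce (S : Set V)).toHom
    have h := hS.card_le_of_colorable hcS
    simp only [Finset.coe_sort_coe, Fintype.card_coe] at h
    rw [Nat.ceil_le, div_le_iff₀ hhalf, mul_comm]
    exact_mod_cast h
  refine ⟨?_, ?_⟩
  · rw [← hc]
    rcases hclique.eq_or_lt with h | h
    · left
      simp [h]
    · right
      -- As `ω < c`, the value `c - 1` is still at least `ω`, but too small for a colouring; the
      -- resulting hyperhole forces the ceiling above `c - 1`.
      rcases D.colorable_or_exists_isHyperhole hk (r := c - 1) (by omega) with h1 | ⟨S, hS, hcard⟩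
      · have h2 := h1.chromaticNumber_le
        rw [← hc] at h2
        have : c ≤ c - 1 := by exact_mod_cast h2
        omega
      · refine ⟨S, hS, ?_⟩
        have h1 : c ≤ ⌈(S.card : ℚ) / ((k / 2 : ℕ) : ℚ)⌉₊ := by
          have h2 : c - 1 < ⌈(S.card : ℚ) / ((k / 2 : ℕ) : ℚ)⌉₊ := by
            rw [Nat.lt_ceil, lt_div_iff₀ hhalf, mul_comm]
            exact_mod_cast hcard
          omega
        rw [le_antisymm h1 (hhole S hS)]
  · rw [← hc]
    rintro m (rfl | ⟨S, hS, rfl⟩)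
    · exact_mod_cast hclique
    · exact_mod_cast hhole S hS
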